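/- Let $d\ge 0$ and let $S^d$ be the unit sphere of $\mathbb R^{d+1}$ with the metric induced from the Euclidean metric of $\mathbb R^{d+1}$. Let $0<\varepsilon<\sqrt2$ and let $X\subset S^d$ be an $\varepsilon$-net, that is, every point of $S^d$ is at distance at most $\varepsilon$ from some point of $X$, and for some $\delta>0$ any two distinct points of $X$ are at distance at least $\delta$ (so $X$ is finite). Let $T$ be any total order on $X$. Then there exist two antipodal points $x$ and $\dot x=-x$ of $S^d$ and a snake on $d+2$ points of $X$, i.e. points $x_1<_T x_2<_T\dots<_T x_{d+2}$ of $X$, such that $d(x_i,x)\le\varepsilon$ if $i$ is odd and $d(x_i,\dot x)\le\varepsilon$ if $i$ is even. In particular, the diameter of the set $\{x_1,\dots,x_{d+2}\}$ is at least $2-2\varepsilon$, and the width of the snake, i.e. the maximum of $d(x_i,x_j)$ over $i,j$ of the same parity, is at most $2\varepsilon$. Moreover, $$\operatorname{OR}_{S^d}(d+1)=d+1 .$$ Here, for a metric space $M$ with at least two points, a total order $T$ on $M$ and $k\ge1$, $$\operatorname{OR}_{M,T}(k)=\sup_{X\subset M,\ 2\le \#X\le k+1}\frac{l_T(X)}{l_{\rm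 opt}(X)},\qquad \operatorname{OR}_M(k)=\inf_T \operatorname{OR}_{M,T}(k),$$ where, for a finite set $X=\{x_1<_T\dots<_T x_n\}$, $l_T(X)=\sum_{i=1}^{n-1}d(x_i,x_{i+1})$, and $l_{\rm opt}(X)$ is the minimal length $\sum_i d(y_i,y_{i+1})$ of a finite sequence $(y_i)$ of points of $M$ which visits all points of $X$; the infimum is over all total orders $T$ on $M$. -/

import Mathlib

open scoped ENNReal

noncomputable section

/-- The unit sphere `S^d` in `ℝ^(d+1)`, with the metric induced from the Euclidean norm. -/
abbrev UnitSphere (d : ℕ) : Type :=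
  Metric.sphere (0 : EuclideanSpace ℝ (Fin (d + 1))) 1

/-- An `(ε, δ)`-net of a metric space: every point is at distance at most `ε` from a point of `U`,
and distinct points of `U` are at distance at least `δ` from each other. -/
structure IsNet {M : Type*} [MetricSpace M] (ε δ : ℝ) (U : Set M) : Prop where
  covers : ∀ p : M, ∃ u ∈ U, dist p u ≤ ε
  separated : ∀ u ∈ U, ∀ v ∈ U, u ≠ v → δ ≤ dist u v

/-- A snake on `n` points of `M` with respect to a total order `T`: a strictly `T`-increasing
sequence of `n` points. -/
def IsSnake {M : Type*} (T : LinearOrder M) {n : ℕ} (s : Fin n → M) : Prop :=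
  ∀ i j : Fin n, i < j → T.lt (s i) (s j)

/-- The length of a snake: the diameter of the set of its points. -/
def snakeLength {M : Type*} [MetricSpace M] {n : ℕ} (s : Fin n → M) : ℝ :=
  Metric.diam (Set.range s)

/-- The width of a snake: the maximal distance between two of its points whose indices have the
same parity. -/
def snakeWidth {M : Type*} [MetricSpace M] {n : ℕ} (s : Fin n → M) : ℝ :=
  sSup {r : ℝ | ∃ i j : Fin n, (i : ℕ) % 2 = (j : ℕ) % 2 ∧ r = dist (s i) (s j)}

/-- The length `d(x₁, x₂) + d(x₂, x₃) + ⋯` of the path through the points of a list. -/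
def pathLength {M : Type*} [MetricSpace M] : List M → ℝ
  | [] => 0
  | [_] => 0
  | x :: y :: l => dist x y + pathLength (y :: l)

/-- The minimal length `l_opt(X)` of a path (a finite sequence of points of `M`) which visits all
points of the finite set `X`. -/
def optLength {M : Type*} [MetricSpace M] (X : Finset M) : ℝ :=
  sInf {r : ℝ | ∃ l : List M, (∀ x ∈ X, x ∈ l) ∧ r = pathLength l}

/-- The length `l_T(X)` of the path which visits the points of the finite set `X` in the order
given by `T`. -/
def orderLength {M : Type*} [MetricSpace M] (T : LinearOrder M) (X : Finset M) : ℝ :=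
  letI := T
  pathLength (X.sort (fun a b => a ≤ b))

open Classical in
/-- The order ratio function `OR_{M,T}(k)`: the supremum of `l_T(X) / l_opt(X)` over the finite
subsets `X` of `M` with `2 ≤ #X ≤ k + 1`. For a space with at most one point it is `1` by
convention. -/
def orderRatio (M : Type*) [MetricSpace M] (T : LinearOrder M) (k : ℕ) : ℝ≥0∞ :=
  if Subsingleton M then 1
  else ⨆ (X : Finset M) (_ : 2 ≤ X.card ∧ X.card ≤ k + 1),
    ENNReal.ofReal (orderLength T X / optLength X)

/-- The order ratio function `OR_M(k)` of an unordered metric space: the infimum of `OR_{M,T}(k)`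
over all total orders `T` on `M`. -/
def spaceOrderRatio (M : Type*) [MetricSpace M] (k : ℕ) : ℝ≥0∞ :=
  ⨅ T : LinearOrder M, orderRatio M T k

end

/-! The snake comes from a version of Fan's lemma, proved by counting simplices mod 2. Label each
point `v` of the sphere by an index `m v` of a net point within `ε` of it. Since `ε < √2`, no net
point is near both to a point and to the antipode of a nearby point (parallelogram law), so `m v ≠ m
(-w)` for `v`, `w` close. The smaller of `m v` and `m (-v)`, together with the side on which it
occurs, is then a signed label which changes sign under the antipodal map (`antipodalLabel`).

Fine chains `c k` of hemispheres satisfy `∂ c (k + 1) = c k + (-c k)`, where `-c k` is the antipodal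
image. Their labelled and sorted images `b k` satisfy the same relation with sign flip. The number
mod 2 of sign-alternating words in `b k` does not depend on `k` (`alt_eq_of_bd`) and is 1 for `k =
0`. Hence a small simplex carries `d + 1` increasing labels with alternating signs; the larger value
at its last vertex supplies the label `d + 2` (`exists_alternating_labels`). Compactness removes the
error term (`exists_snake`).

For the order ratio, each of at most `d + 1` steps is no longer than an optimal path, so every order
has ratio at most `d + 1`. Conversely, a snake on `d + 2` points makes `d + 1` jumps of length
nearly 2, while visiting one cluster after the other costs little more than 2; let `ε → 0`. -/

noncomputable section

/-! ### Mod 2 chains of words: boundary and prism operators -/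

/-- Chains with coefficients in `ℤ/2` on the words in the alphabet `V`. -/
abbrev WordChain (V : Type*) : Type _ := List V →₀ ZMod 2

namespace WordChain

variable {V W : Type*}

theorem add_self (x : WordChain V) : x + x = 0 := by
  ext w
  exact CharTwo.add_self_eq_zero _

/-- The chain of a single word. -/
def word (w : List V) : WordChain V := Finsupp.single w 1

/-- The linear map on chains with given values on words. -/
def extend {N : Type*} [AddCommGroup N] [Module (ZMod 2) N] (f : List V → N) :
    WordChain V →ₗ[ZMod 2] N :=
  Finsupp.linearCombination (ZMod 2) f

@[simp] theorem extend_word {N : Type*} [AddCommGroup N] [Module (ZMod 2) N] (f : List V → N)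
    (w : List V) : extend f (word w) = f w := by
  simp [extend, word]

theorem hom_ext {N : Type*} [AddCommGroup N] [Module (ZMod 2) N]
    {f g : WordChain V →ₗ[ZMod 2] N} (h : ∀ w, f (word w) = g (word w)) : f = g :=
  Finsupp.lhom_ext' fun w => LinearMap.ext_ring (h w)

/-- The chains all of whose words lie in the set `s`. -/
abbrev On (s : Set (List V)) : Submodule (ZMod 2) (WordChain V) :=
  Finsupp.supported (ZMod 2) (ZMod 2) s

theorem word_mem {s : Set (List V)} {w : List V} (h : w ∈ s) : word w ∈ On s :=
  Finsupp.single_mem_supported _ _ h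

theorem on_eq_span (s : Set (List V)) : On s = Submodule.span (ZMod 2) (word '' s) :=
  Finsupp.supported_eq_span_single _ _

theorem on_le_of_word {s : Set (List V)} {S : Submodule (ZMod 2) (WordChain V)}
    (h : ∀ w ∈ s, word w ∈ S) : On s ≤ S := by
  rw [on_eq_span, Submodule.span_le]
  rintro _ ⟨w, hw, rfl⟩
  exact h w hw

theorem map_mem {s : Set (List V)} {t : Set (List W)} {F : WordChain V →ₗ[ZMod 2] WordChain W}
    (h : ∀ w ∈ s, F (word w) ∈ On t) {x : WordChain V} (hx : x ∈ On s) : F x ∈ On t :=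
  on_le_of_word (S := (On t).comap F) h hx

theorem eqOn {N : Type*} [AddCommGroup N] [Module (ZMod 2) N] {s : Set (List V)}
    {F G : WordChain V →ₗ[ZMod 2] N} (h : ∀ w ∈ s, F (word w) = G (word w))
    {x : WordChain V} (hx : x ∈ On s) : F x = G x :=
  on_le_of_word (S := LinearMap.eqLocus F G) h hx

/-- Prepend a letter. -/
def cons (v : V) : WordChain V →ₗ[ZMod 2] WordChain V := extend fun w => word (v :: w)

@[simp] theorem cons_word (v : V) (w : List V) : cons v (word w) = word (v :: w) := by
  simp [cons]

/-- The map on chains induced by a map of alphabets. -/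
def map (f : V → W) : WordChain V →ₗ[ZMod 2] WordChain W := extend fun w => word (w.map f)

@[simp] theorem map_word (f : V → W) (w : List V) : map f (word w) = word (w.map f) := by
  simp [map]

theorem map_cons (f : V → W) (v : V) (x : WordChain V) :
    map f (cons v x) = cons (f v) (map f x) := by
  refine LinearMap.congr_fun (f := map f ∘ₗ cons v) (g := cons (f v) ∘ₗ map f) (hom_ext ?_) x
  simp

theorem map_map {U : Type*} (g : W → U) (f : V → W) (x : WordChain V) :
    map g (map f x) = map (g ∘ f) x := by
  refine LinearMap.congr_fun (f := map g ∘ₗ map f) (g := map (g ∘ f)) (hom_ext ?_) x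
  simp

theorem map_id (x : WordChain V) : map id x = x := by
  refine LinearMap.congr_fun (f := map id) (g := LinearMap.id) (hom_ext ?_) x
  simp

/-- The boundary of a word. -/
def bdWord : List V → WordChain V
  | [] => 0
  | v :: w => word w + cons v (bdWord w)

/-- The boundary map: the sum of all words obtained by deleting one letter. -/
def bd : WordChain V →ₗ[ZMod 2] WordChain V := extend bdWord

@[simp] theorem bd_word (w : List V) : bd (word w) = bdWord w := by simp [bd]

theorem bd_cons (v : V) (x : WordChain V) : bd (cons v x) = x + cons v (bd x) := by
  refine LinearMap.congr_fun (f := bd ∘ₗ cons v) (g := LinearMap.id + cons v ∘ₗ bd)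
    (hom_ext fun w => ?_) x
  simp [bdWord]

theorem bd_map (f : V → W) (x : WordChain V) : bd (map f x) = map f (bd x) := by
  refine LinearMap.congr_fun (f := bd ∘ₗ map f) (g := map f ∘ₗ bd) (hom_ext fun w => ?_) x
  simp only [LinearMap.comp_apply, map_word, bd_word]
  induction w with
  | nil => simp [bdWord]
  | cons v w ih => simp [bdWord, map_cons, ih]

/-- The prism on a word between two maps of alphabets. -/
def prismWord (f g : V → W) : List V → WordChain W
  | [] => 0
  | v :: w => cons (f v) (prismWord f g w) + word (f v :: g v :: w.map g)

/-- The prism operator between two maps of alphabets. -/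
def prism (f g : V → W) : WordChain V →ₗ[ZMod 2] WordChain W := extend (prismWord f g)

@[simp] theorem prism_word (f g : V → W) (w : List V) :
    prism f g (word w) = prismWord f g w := by simp [prism]

theorem prism_cons (f g : V → W) (v : V) (x : WordChain V) :
    prism f g (cons v x) = cons (f v) (prism f g x) + cons (f v) (cons (g v) (map g x)) := by
  refine LinearMap.congr_fun (f := prism f g ∘ₗ cons v)
    (g := cons (f v) ∘ₗ prism f g + cons (f v) ∘ₗ cons (g v) ∘ₗ map g) (hom_ext fun w => ?_) x
  simp [prismWord]

/-- The usual chain homotopy between `map f` and `map g`. In the induction on the first letter, the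
word `f v :: w.map g` is the only term that occurs twice, and it cancels mod 2. -/
theorem bd_prism (f g : V → W) (x : WordChain V) :
    bd (prism f g x) = map f x + map g x + prism f g (bd x) := by
  refine LinearMap.congr_fun (f := bd ∘ₗ prism f g) (g := map f + map g + prism f g ∘ₗ bd)
    (hom_ext fun w => ?_) x
  simp only [LinearMap.comp_apply, LinearMap.add_apply, map_word, bd_word, prism_word]
  induction w with
  | nil => simp [bdWord, prismWord, add_self]
  | cons v w ih =>
    have h1 : bd (word (f v :: g v :: w.map g)) = word (g v :: w.map g) +
        (cons (f v) (word (w.map g)) + cons (f v) (cons (g v) (map g (bdWord w)))) := by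
      rw [← cons_word, ← cons_word, bd_cons, bd_cons, map_add]
      have := bd_map g (word w)
      simp only [map_word, bd_word] at this
      simp [this]
    simp only [bdWord, prismWord, map_add, bd_cons, ih, h1, prism_cons, prism_word, cons_word,
      List.map_cons]
    have e := add_self (word (f v :: w.map g))
    generalize word (f v :: w.map g) = A at *
    generalize word (f v :: w.map f) = B
    generalize word (g v :: w.map g) = C
    generalize prismWord f g w = D
    generalize cons (f v) (prism f g (bdWord w)) = X
    generalize cons (f v) (cons (g v) (map g (bdWord w))) = Y
    calc D + (B + A + X) + (C + (A + Y)) = B + C + (D + (X + Y)) + (A + A) := by abel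
      _ = B + C + (D + (X + Y)) := by rw [e, add_zero]

theorem prismWord_mem (f g : V → W) (w : List V) :
    prismWord f g w ∈ On {u | u.length = w.length + 1 ∧
      ∀ x ∈ u, ∃ v ∈ w, x = f v ∨ x = g v} := by
  induction w with
  | nil => exact zero_mem _
  | cons v w ih =>
    refine add_mem (map_mem (fun u hu => ?_) ih) (word_mem ⟨by simp, ?_⟩)
    · rw [cons_word]
      refine word_mem ⟨by simp [hu.1], ?_⟩
      intro x hx
      rcases List.mem_cons.1 hx with rfl | hx
      · exact ⟨v, by simp, Or.inl rfl⟩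
      · obtain ⟨y, hy, h⟩ := hu.2 x hx
        exact ⟨y, by simp [hy], h⟩
    · intro x hx
      simp only [List.mem_cons, List.mem_map] at hx
      rcases hx with rfl | rfl | ⟨y, hy, rfl⟩
      · exact ⟨v, by simp, Or.inl rfl⟩
      · exact ⟨v, by simp, Or.inr rfl⟩
      · exact ⟨y, by simp [hy], Or.inr rfl⟩

/-! ### Sorting as a chain map -/

section Sorting

variable [LinearOrder V]

/-- Insert a letter into a sorted word; the result is zero if the letter is already present. -/
def insertWord (a : V) : List V → WordChain V
  | [] => word [a]
  | b :: u => if a < b then word (a :: b :: u) else if a = b then 0 else cons b (insertWord a u)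

/-- Linear extension of `insertWord`. -/
def insert (a : V) : WordChain V →ₗ[ZMod 2] WordChain V := extend (insertWord a)

@[simp] theorem insert_word (a : V) (u : List V) : insert a (word u) = insertWord a u := by
  simp [insert]

theorem insert_cons (a b : V) (x : WordChain V) : insert a (cons b x) =
    if a < b then cons a (cons b x) else if a = b then 0 else cons b (insert a x) := by
  split_ifs with h1 h2
  · refine LinearMap.congr_fun (f := insert a ∘ₗ cons b) (g := cons a ∘ₗ cons b)
      (hom_ext fun w => ?_) x
    simp [insertWord, h1]
  · refine LinearMap.congr_fun (f := insert a ∘ₗ cons b) (g := 0) (hom_ext fun w => ?_) x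
    simp [insertWord, h2]
  · refine LinearMap.congr_fun (f := insert a ∘ₗ cons b) (g := cons b ∘ₗ insert a)
      (hom_ext fun w => ?_) x
    simp [insertWord, h1, h2]

theorem insertWord_of_lt {a : V} {u : List V} (h : ∀ b ∈ u, a < b) :
    insertWord a u = word (a :: u) := by
  cases u with
  | nil => rfl
  | cons b u => simp [insertWord, h b (by simp)]

/-- Mod 2 the order of letters carries no sign, so insertion has the same boundary formula as
`cons`. If `a` is already in `u`, the left side is zero, and on the right the word obtained by
deleting `a` from `u` and reinserting it cancels `u`. -/
theorem bd_insertWord (a : V) {u : List V} (hu : u.Pairwise (· < ·)) :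
    bd (insertWord a u) = word u + insert a (bdWord u) := by
  induction u with
  | nil => simp [insertWord, bdWord]
  | cons b u ih =>
    rw [List.pairwise_cons] at hu
    by_cases h1 : a < b
    · have h2 : insertWord a u = word (a :: u) :=
        insertWord_of_lt fun c hc => h1.trans (hu.1 c hc)
      simp [insertWord, h1, bdWord, insert_cons, h2]
    · by_cases h2 : a = b
      · subst h2
        simp [insertWord, bdWord, insert_cons, insertWord_of_lt hu.1, add_self]
      · simp only [insertWord, h1, h2, if_false, bd_cons, ih hu.2, bdWord, map_add, insert_cons,
          insert_word, cons_word]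
        abel

/-- The sorted word of a word without repetitions, and zero for a word with repetitions. -/
def sortWord : List V → WordChain V
  | [] => word []
  | a :: w => insert a (sortWord w)

/-- Linear extension of `sortWord`. -/
def sort : WordChain V →ₗ[ZMod 2] WordChain V := extend sortWord

@[simp] theorem sort_word (w : List V) : sort (word w) = sortWord w := by simp [sort]

theorem sort_cons (a : V) (x : WordChain V) : sort (cons a x) = insert a (sort x) := by
  refine LinearMap.congr_fun (f := sort ∘ₗ cons a) (g := insert a ∘ₗ sort)
    (hom_ext fun w => ?_) x
  simp [sortWord]

theorem insertWord_mem (a : V) {u : List V} (hu : u.Pairwise (· < ·)) :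
    insertWord a u ∈ On {t | t.Pairwise (· < ·) ∧ t.length = u.length + 1 ∧
      ∀ x ∈ t, x = a ∨ x ∈ u} := by
  induction u with
  | nil => exact word_mem (by simp)
  | cons b u ih =>
    rw [List.pairwise_cons] at hu
    simp only [insertWord]
    split_ifs with h1 h2
    · refine word_mem ⟨?_, by simp, by simp⟩
      rw [List.pairwise_cons, List.pairwise_cons]
      refine ⟨?_, hu⟩
      intro c hc
      rcases List.mem_cons.1 hc with rfl | hc
      · exact h1
      · exact h1.trans (hu.1 c hc)
    · exact zero_mem _
    · refine map_mem (fun t ht => ?_) (ih hu.2)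
      rw [cons_word]
      refine word_mem ⟨List.pairwise_cons.2 ⟨?_, ht.1⟩, by simp [ht.2.1], ?_⟩
      · intro c hc
        rcases ht.2.2 c hc with rfl | hc
        · exact lt_of_le_of_ne (not_lt.1 h1) (Ne.symm h2)
        · exact hu.1 c hc
      · intro x hx
        rcases List.mem_cons.1 hx with rfl | hx
        · simp
        · rcases ht.2.2 x hx with rfl | hx <;> simp [*]

theorem sortWord_mem (w : List V) :
    sortWord w ∈ On {t | t.Pairwise (· < ·) ∧ t.length = w.length ∧ ∀ x ∈ t, x ∈ w} := by
  induction w with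
  | nil => exact word_mem (by simp)
  | cons a w ih =>
    refine map_mem (fun t ht => ?_) ih
    rw [insert_word]
    refine Finsupp.supported_mono ?_ (insertWord_mem a ht.1)
    rintro s ⟨h1, h2, h3⟩
    refine ⟨h1, by simp [h2, ht.2.1], fun x hx => ?_⟩
    rcases h3 x hx with rfl | hx
    · simp
    · simp [ht.2.2 x hx]

theorem bd_sort (x : WordChain V) : bd (sort x) = sort (bd x) := by
  suffices h : (bd ∘ₗ sort : WordChain V →ₗ[ZMod 2] WordChain V) = sort ∘ₗ bd from
    LinearMap.congr_fun h x
  refine hom_ext fun w => ?_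
  rw [LinearMap.comp_apply, LinearMap.comp_apply, sort_word, bd_word]
  induction w with
  | nil => simp [sortWord, bdWord]
  | cons a w ih =>
    have key : bd (insert a (sortWord w)) = sortWord w + insert a (bd (sortWord w)) :=
      eqOn (F := bd ∘ₗ insert a) (G := LinearMap.id + insert a ∘ₗ bd)
        (fun t ht => by simpa using bd_insertWord a ht.1) (sortWord_mem w)
    rw [sortWord, key, ih, bdWord, map_add, sort_word, sort_cons]

/-- Sorting commutes with a map of the alphabet which preserves the order of the letters of the
word. -/
theorem sortWord_map {U : Type*} [LinearOrder U] (f : V → U) {w : List V}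
    (hf : ∀ a ∈ w, ∀ b ∈ w, a < b → f a < f b) :
    sortWord (w.map f) = map f (sortWord w) := by
  induction w with
  | nil => simp [sortWord]
  | cons a w ih =>
    have ih' := ih fun x hx y hy => hf x (by simp [hx]) y (by simp [hy])
    rw [List.map_cons, sortWord, sortWord, ih']
    refine eqOn (F := insert (f a) ∘ₗ map f) (G := map f ∘ₗ insert a) (fun t ht => ?_)
      (sortWord_mem w)
    have h3 : ∀ x ∈ t, x ∈ w := ht.2.2
    clear ht
    simp only [LinearMap.comp_apply, map_word, insert_word]
    induction t with
    | nil => simp [insertWord]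
    | cons b t iht =>
      have hb : b ∈ a :: w := by simp [h3 b (by simp)]
      have ha : a ∈ a :: w := by simp
      rcases lt_trichotomy a b with h | h | h
      · simp [insertWord, h, hf a ha b hb h]
      · subst h
        simp [insertWord]
      · have h' := hf b hb a ha h
        simp [insertWord, h.not_gt, h'.not_gt, h.ne', h'.ne', map_cons,
          iht fun x hx => h3 x (by simp [hx])]

end Sorting

/-! ### Counting alternating words mod 2 -/

section Alternating

variable (s : V → ZMod 2)

/-- The product of the differences of `s` along consecutive letters of a word. -/
def altWord : List V → ZMod 2
  | [] => 0
  | [_] => 1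
  | a :: b :: u => (s a + s b) * altWord (b :: u)

/-- Linear extension of `altWord`. -/
def alt : WordChain V →ₗ[ZMod 2] ZMod 2 := extend (altWord s)

@[simp] theorem alt_word (w : List V) : alt s (word w) = altWord s w := by simp [alt]

/-- The product of `altWord` with the value of `s` at the first letter. -/
def halfAltWord : List V → ZMod 2
  | [] => 0
  | a :: u => s a * altWord s (a :: u)

/-- Linear extension of `halfAltWord`. -/
def halfAlt : WordChain V →ₗ[ZMod 2] ZMod 2 := extend (halfAltWord s)

@[simp] theorem halfAlt_word (w : List V) : halfAlt s (word w) = halfAltWord s w := by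
  simp [halfAlt]

theorem alt_cons_cons (a b : V) (x : WordChain V) :
    alt s (cons a (cons b x)) = (s a + s b) * alt s (cons b x) := by
  refine LinearMap.congr_fun (f := alt s ∘ₗ cons a ∘ₗ cons b)
    (g := (s a + s b) • (alt s ∘ₗ cons b)) (hom_ext fun w => ?_) x
  simp [altWord]

theorem halfAlt_cons (a : V) (x : WordChain V) :
    halfAlt s (cons a x) = s a * alt s (cons a x) := by
  refine LinearMap.congr_fun (f := halfAlt s ∘ₗ cons a)
    (g := s a • (alt s ∘ₗ cons a)) (hom_ext fun w => ?_) x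
  simp [halfAltWord]

/-- Alternating faces come in pairs: an alternating word has only its two end faces alternating, a
word with a single repeated sign has the two faces that delete one of the equal neighbours, and
other words have none. -/
theorem alt_bdWord (a b : V) (u : List V) : alt s (bdWord (a :: b :: u)) = 0 := by
  induction u generalizing a b with
  | nil => simp [bdWord, altWord, CharTwo.add_self_eq_zero]
  | cons c u ih =>
    have h := ih b c
    simp only [bdWord, map_add, cons_word, alt_word, altWord, alt_cons_cons] at h ⊢
    have h2 : (2 : ZMod 2) = 0 := rfl
    linear_combination (s a + s b) * h + (s c * altWord s (c :: u)) * h2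

/-- Of the two alternating end faces of an alternating word, exactly one begins with sign 1. The two
faces from a repeated sign have the same sign pattern and cancel. -/
theorem halfAlt_bdWord (a b : V) (u : List V) :
    halfAlt s (bdWord (a :: b :: u)) = altWord s (a :: b :: u) := by
  have h := alt_bdWord s a b u
  simp only [bdWord, map_add, cons_word, alt_word, halfAlt_word, halfAltWord, altWord,
    alt_cons_cons, halfAlt_cons] at h ⊢
  have h2 : (2 : ZMod 2) = 0 := rfl
  linear_combination (s a) * h - s a * altWord s (b :: u) * h2

theorem altWord_map (f : V → V) (hf : ∀ a, s (f a) = s a + 1) (w : List V) :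
    altWord s (w.map f) = altWord s w := by
  match w with
  | [] => rfl
  | [_] => rfl
  | a :: b :: u =>
    have h := altWord_map f hf (b :: u)
    have h2 : (2 : ZMod 2) = 0 := rfl
    simp only [List.map_cons, altWord, hf] at h ⊢
    rw [h]
    linear_combination altWord s (b :: u) * h2

theorem halfAlt_add_map (f : V → V) (hf : ∀ a, s (f a) = s a + 1) (x : WordChain V) :
    halfAlt s (x + map f x) = alt s x := by
  refine LinearMap.congr_fun (f := halfAlt s ∘ₗ (LinearMap.id + map f)) (g := alt s)
    (hom_ext fun w => ?_) x
  cases w with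
  | nil => simp [halfAltWord, altWord]
  | cons a u =>
    have h := altWord_map s f hf (a :: u)
    have h2 : (2 : ZMod 2) = 0 := rfl
    simp only [List.map_cons] at h
    simp only [LinearMap.comp_apply, LinearMap.add_apply, LinearMap.id_apply, map_add, map_word,
      List.map_cons, halfAlt_word, halfAltWord, alt_word, h, hf]
    linear_combination s a * altWord s (a :: u) * h2

theorem isChain_of_altWord_ne_zero {w : List V} (h : altWord s w ≠ 0) :
    w.IsChain fun a b => s a ≠ s b := by
  match w with
  | [] => exact .nil
  | [_] => exact .singleton _
  | a :: b :: u =>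
    simp only [altWord] at h
    refine .cons_cons ?_ (isChain_of_altWord_ne_zero (right_ne_zero_of_mul h))
    intro hab
    exact left_ne_zero_of_mul h (by rw [hab, CharTwo.add_self_eq_zero])

/-- Along a sequence of chains with `∂ b (k + 1) = b k + f (b k)` the value of `alt` is
constant. -/
theorem alt_eq_of_bd (f : V → V) (hf : ∀ a, s (f a) = s a + 1) (b : ℕ → WordChain V)
    {n : ℕ} (hb : ∀ k ≤ n, b k ∈ On {w | w.length = k + 1})
    (hbd : ∀ k < n, bd (b (k + 1)) = b k + map f (b k)) {k : ℕ} (hk : k ≤ n) :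
    alt s (b k) = alt s (b 0) := by
  induction k with
  | zero => rfl
  | succ k ih =>
    -- Each alternating word or its flip begins with sign 1, so `alt (b k)` is `halfAlt` of `∂ b (k
    -- + 1)`, which is `alt (b (k + 1))` because the words there have at least two letters.
    rw [← ih (by lia), ← halfAlt_add_map s f hf (b k), ← hbd k (by lia)]
    refine (eqOn (F := halfAlt s ∘ₗ bd) (G := alt s) (fun w hw => ?_) (hb (k + 1) hk)).symm
    match w, hw with
    | a :: c :: u, _ => simp [halfAlt_bdWord]

end Alternating

end WordChain

end

noncomputable section

/-! ### Rotation towards a pole -/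

section Rotation

variable {F : Type*} [NormedAddCommGroup F] [InnerProductSpace ℝ F]

/-- The point at angle `t` on the quarter of a great circle from `v` to `e`. -/
def rotateTo (e : F) (t : ℝ) (v : F) : F := Real.cos t • v + Real.sin t • e

theorem norm_rotateTo {e v : F} (he : ‖e‖ = 1) (hv : ‖v‖ = 1) (hev : inner ℝ e v = 0) (t : ℝ) :
    ‖rotateTo e t v‖ = 1 := by
  have h : ‖rotateTo e t v‖ * ‖rotateTo e t v‖ = 1 := by
    rw [rotateTo, norm_add_sq_eq_norm_sq_add_norm_sq_real]
    · rw [norm_smul, norm_smul, he, hv, Real.norm_eq_abs, Real.norm_eq_abs, mul_one, mul_one,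
        abs_mul_abs_self, abs_mul_abs_self]
      linarith [Real.sin_sq_add_cos_sq t]
    · rw [inner_smul_left, inner_smul_right, real_inner_comm, hev]
      simp
  nlinarith [norm_nonneg (rotateTo e t v)]

theorem inner_rotateTo {e v x : F} (he : inner ℝ x e = 0) (hv : inner ℝ x v = 0) (t : ℝ) :
    inner ℝ x (rotateTo e t v) = 0 := by
  simp [rotateTo, inner_add_right, inner_smul_right, he, hv]

theorem dist_rotateTo_le (e v w : F) (t : ℝ) :
    dist (rotateTo e t v) (rotateTo e t w) ≤ dist v w := by
  rw [rotateTo, rotateTo, dist_add_right, dist_smul₀, Real.norm_eq_abs]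
  exact mul_le_of_le_one_left dist_nonneg (Real.abs_cos_le_one t)

theorem dist_rotateTo_le_angle {e v : F} (he : ‖e‖ = 1) (hv : ‖v‖ = 1) (t u : ℝ) :
    dist (rotateTo e t v) (rotateTo e u v) ≤ 2 * |t - u| := by
  have h : rotateTo e t v - rotateTo e u v =
      (Real.cos t - Real.cos u) • v + (Real.sin t - Real.sin u) • e := by
    simp only [rotateTo]
    module
  rw [dist_eq_norm, h]
  refine (norm_add_le _ _).trans ?_
  rw [norm_smul, norm_smul, he, hv, Real.norm_eq_abs, Real.norm_eq_abs, mul_one, mul_one]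
  linarith [Real.abs_sin_sub_sin_le t u, Real.abs_cos_sub_cos_le t u]

end Rotation

open WordChain

/-! ### Fine chains of hemispheres -/

section SphereChain

variable {F : Type*} [NormedAddCommGroup F]

/-- A chain symmetrized by the antipodal map. -/
def symmetrize (c : WordChain F) : WordChain F := c + map (fun v => -v) c

theorem map_neg_symmetrize (c : WordChain F) : map (fun v => -v) (symmetrize c) = symmetrize c := by
  have h : (fun v : F => -v) ∘ (fun v => -v) = id := by
    ext v
    simp
  rw [symmetrize, map_add, map_map, h, map_id, add_comm]

theorem bd_symmetrize (c : WordChain F) : bd (symmetrize c) = symmetrize (bd c) := by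
  rw [symmetrize, map_add, bd_map, symmetrize]

variable [InnerProductSpace ℝ F]

/-- Chains of words of nearby points which represent the hemispheres of the spheres spanned by
`e 0, …, e k`; the quarter circles to the poles are cut into `N` arcs. -/
def hemisphereChain (e : ℕ → F) (N : ℕ) : ℕ → WordChain F
  | 0 => word [e 0]
  | k + 1 => ∑ j ∈ Finset.range N,
      prism (rotateTo (e (k + 1)) (j * (Real.pi / (2 * N))))
        (rotateTo (e (k + 1)) ((j + 1 : ℕ) * (Real.pi / (2 * N))))
        (symmetrize (hemisphereChain e N k))

theorem sum_range_add_succ {M : Type*} [AddCommGroup M] (h2 : ∀ x : M, x + x = 0) (a : ℕ → M)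
    (n : ℕ) : ∑ j ∈ Finset.range n, (a j + a (j + 1)) = a 0 + a n := by
  induction n with
  | zero => simp [h2]
  | succ n ih =>
    rw [Finset.sum_range_succ, ih]
    calc a 0 + a n + (a n + a (n + 1)) = a 0 + a (n + 1) + (a n + a n) := by abel
      _ = _ := by rw [h2, add_zero]

/-- The sides of the prisms vanish because the symmetrized chain is a cycle, and the ends telescope
to angles `0` and `π / 2`. At `π / 2` everything collapses to the pole `e`, where antipodal words
have the same image and cancel. -/
theorem bd_sum_prism (e : F) {N : ℕ} (hN : 0 < N) {c : WordChain F}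
    (hc : bd (symmetrize c) = 0) :
    bd (∑ j ∈ Finset.range N, prism (rotateTo e (j * (Real.pi / (2 * N))))
      (rotateTo e ((j + 1 : ℕ) * (Real.pi / (2 * N)))) (symmetrize c)) = symmetrize c := by
  have hN' : (N : ℝ) ≠ 0 := by positivity
  rw [map_sum]
  simp only [bd_prism, hc, map_zero, add_zero]
  rw [sum_range_add_succ add_self
    (fun j : ℕ => map (rotateTo e (j * (Real.pi / (2 * N)))) (symmetrize c))]
  have h0 : rotateTo e ((0 : ℕ) * (Real.pi / (2 * N))) = id := by
    ext v
    simp [rotateTo]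
  have h1 : rotateTo e (N * (Real.pi / (2 * N))) = fun _ => e := by
    ext v
    have : (N : ℝ) * (Real.pi / (2 * N)) = Real.pi / 2 := by field_simp
    rw [this]
    simp [rotateTo]
  have h2 : (fun _ : F => e) ∘ (fun v => -v) = fun _ => e := rfl
  rw [h0, h1, map_id, symmetrize, map_add, map_map, h2, add_self, add_zero]

theorem bd_symmetrize_hemisphereChain (e : ℕ → F) {N : ℕ} (hN : 0 < N) (k : ℕ) :
    bd (symmetrize (hemisphereChain e N k)) = 0 := by
  induction k with
  | zero =>
    simp [hemisphereChain, symmetrize, bdWord, add_self]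
  | succ k ih =>
    rw [bd_symmetrize, hemisphereChain, bd_sum_prism _ hN ih]
    nth_rw 1 [symmetrize]
    rw [map_neg_symmetrize, add_self]

theorem bd_hemisphereChain (e : ℕ → F) {N : ℕ} (hN : 0 < N) (k : ℕ) :
    bd (hemisphereChain e N (k + 1)) = symmetrize (hemisphereChain e N k) :=
  bd_sum_prism _ hN (bd_symmetrize_hemisphereChain e hN k)

/-- Words of `k + 1` unit vectors at mutual distance at most `k * h`, orthogonal to the vectors
`e j` with `k < j ≤ d`. -/
def smallWords (e : ℕ → F) (d : ℕ) (h : ℝ) (k : ℕ) : Set (List F) :=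
  {w | w.length = k + 1 ∧ (∀ v ∈ w, ‖v‖ = 1 ∧ ∀ j, k < j → j ≤ d → inner ℝ (e j) v = 0) ∧
    ∀ v ∈ w, ∀ v' ∈ w, dist v v' ≤ k * h}

theorem symmetrize_mem {e : ℕ → F} {d : ℕ} {h : ℝ} {k : ℕ} {c : WordChain F}
    (hc : c ∈ On (smallWords e d h k)) : symmetrize c ∈ On (smallWords e d h k) := by
  refine add_mem hc (map_mem (fun w hw => ?_) hc)
  rw [map_word]
  refine word_mem ⟨by simpa using hw.1, ?_, ?_⟩
  · intro v hv
    obtain ⟨u, hu, rfl⟩ := List.mem_map.1 hv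
    exact ⟨by simpa using (hw.2.1 u hu).1, fun j h1 h2 => by simpa using (hw.2.1 u hu).2 j h1 h2⟩
  · intro v hv v' hv'
    obtain ⟨u, hu, rfl⟩ := List.mem_map.1 hv
    obtain ⟨u', hu', rfl⟩ := List.mem_map.1 hv'
    simpa using hw.2.2 u hu u' hu'

/-- Rotation to a common angle does not increase distances (the factor is a cosine), and passing
between the two ends of an arc of angle `π / (2 * N)` moves a point by at most `π / N`. Each
dimension thus adds `π / N`. -/
theorem hemisphereChain_mem {e : ℕ → F} {d : ℕ} (he : ∀ i ≤ d, ‖e i‖ = 1)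
    (hee : ∀ i ≤ d, ∀ j ≤ d, i ≠ j → inner ℝ (e i) (e j) = 0) {N : ℕ} (hN : 0 < N) {k : ℕ}
    (hk : k ≤ d) : hemisphereChain e N k ∈ On (smallWords e d (Real.pi / N) k) := by
  have hN' : (0 : ℝ) < N := by positivity
  induction k with
  | zero =>
    refine word_mem ⟨by simp, ?_, by simp⟩
    simpa using ⟨he 0 (by lia), fun j hj hjd => hee j hjd 0 (by lia) (by lia)⟩
  | succ k ih =>
    refine sum_mem fun j _ => map_mem (fun w hw => ?_) (symmetrize_mem (ih (by lia)))
    rw [prism_word]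
    refine Finsupp.supported_mono ?_ (prismWord_mem _ _ w)
    rintro u ⟨hu1, hu2⟩
    obtain ⟨hw1, hw2, hw3⟩ := hw
    have key : ∀ x ∈ u, ∃ v ∈ w, ∃ i : ℕ, (i = j ∨ i = j + 1) ∧
        x = rotateTo (e (k + 1)) (i * (Real.pi / (2 * N))) v := by
      intro x hx
      obtain ⟨v, hv, h | h⟩ := hu2 x hx
      · exact ⟨v, hv, j, Or.inl rfl, h⟩
      · exact ⟨v, hv, j + 1, Or.inr rfl, h⟩
    refine ⟨by rw [hu1, hw1], ?_, ?_⟩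
    · intro x hx
      obtain ⟨v, hv, i, -, rfl⟩ := key x hx
      obtain ⟨h1, h2⟩ := hw2 v hv
      refine ⟨norm_rotateTo (he _ hk) h1 (h2 _ (by lia) hk) _, fun l hl hld => ?_⟩
      exact inner_rotateTo (hee l hld _ hk (by lia)) (h2 l (by lia) hld) _
    · intro x hx x' hx'
      obtain ⟨v, hv, i, hi, rfl⟩ := key x hx
      obtain ⟨v', hv', i', hi', rfl⟩ := key x' hx'
      have hii : |(i : ℝ) - i'| ≤ 1 := by
        rcases hi with rfl | rfl <;> rcases hi' with rfl | rfl <;> simp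
      refine (dist_triangle _ (rotateTo (e (k + 1)) (i * (Real.pi / (2 * N))) v') _).trans ?_
      have h1 := (dist_rotateTo_le (e (k + 1)) v v' (i * (Real.pi / (2 * N)))).trans
        (hw3 v hv v' hv')
      have h2 := dist_rotateTo_le_angle (he _ hk) (hw2 v' hv').1 (i * (Real.pi / (2 * N)))
        (i' * (Real.pi / (2 * N)))
      rw [← sub_mul, abs_mul, abs_of_pos (a := Real.pi / (2 * N)) (by positivity)] at h2
      have h3 : |(i : ℝ) - i'| * (Real.pi / (2 * N)) ≤ 1 * (Real.pi / (2 * N)) :=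
        mul_le_mul_of_nonneg_right hii (by positivity)
      have h4 : 2 * (1 * (Real.pi / (2 * N))) = Real.pi / N := by field_simp
      push_cast
      linarith

end SphereChain

/-! ### Antipodal labellings and Fan's theorem -/

section Fan

variable {F : Type*} [NormedAddCommGroup F] {ι : Type*}

/-- Change the sign of a label. -/
def flipLabel (a : ι ×ₗ Bool) : ι ×ₗ Bool := toLex ((ofLex a).1, !(ofLex a).2)

/-- The sign of a label as an element of `ℤ/2`. -/
def labelSign (a : ι ×ₗ Bool) : ZMod 2 := if (ofLex a).2 then 1 else 0

/-- The sign of a label as a unit of `ℝ`. -/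
def labelUnit (a : ι ×ₗ Bool) : ℝ := if (ofLex a).2 then 1 else -1

theorem labelSign_flipLabel (a : ι ×ₗ Bool) : labelSign (flipLabel a) = labelSign a + 1 := by
  rcases h : (ofLex a).2 <;> simp [labelSign, flipLabel, h]
  rfl

theorem labelUnit_eq_neg {a b : ι ×ₗ Bool} (h : labelSign a ≠ labelSign b) :
    labelUnit b = -labelUnit a := by
  rcases ha : (ofLex a).2 <;> rcases hb : (ofLex b).2 <;>
    simp_all [labelSign, labelUnit]

variable [LinearOrder ι]

/-- The smaller of the values of `m` at `v` and at `-v`, together with the point where it is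
taken. -/
def antipodalLabel (m : F → ι) (v : F) : ι ×ₗ Bool :=
  if m v < m (-v) then toLex (m v, true) else toLex (m (-v), false)

theorem antipodalLabel_neg {m : F → ι} {v : F} (h : m v ≠ m (-v)) :
    antipodalLabel m (-v) = flipLabel (antipodalLabel m v) := by
  rcases h.lt_or_gt with h | h <;> simp [antipodalLabel, flipLabel, h, h.not_gt]

/-- Opposite signs with the same index would mean `m v = m (-w)` or `m w = m (-v)`. So no small
simplex has two labels which differ only in sign. -/
theorem antipodalLabel_eq {m : F → ι} {η : ℝ}
    (hm : ∀ v w : F, ‖v‖ = 1 → ‖w‖ = 1 → dist v w ≤ η → m v ≠ m (-w)) {v w : F} (hv : ‖v‖ = 1)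
    (hw : ‖w‖ = 1) (hvw : dist v w ≤ η)
    (h : (ofLex (antipodalLabel m v)).1 = (ofLex (antipodalLabel m w)).1) :
    antipodalLabel m v = antipodalLabel m w := by
  have h1 := hm v w hv hw hvw
  have h2 := hm w v hw hv (by rwa [dist_comm])
  unfold antipodalLabel at *
  split_ifs at * with h3 h4 h4 <;> simp_all

variable [InnerProductSpace ℝ F]

theorem antipodalLabel_spec {m : F → ι} {v : F} (h : m v ≠ m (-v)) :
    m (labelUnit (antipodalLabel m v) • v) = (ofLex (antipodalLabel m v)).1 ∧
      (ofLex (antipodalLabel m v)).1 < m (-(labelUnit (antipodalLabel m v) • v)) := by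
  rcases h.lt_or_gt with h | h <;> simp [antipodalLabel, labelUnit, h, h.not_gt]

/-- **Fan's theorem**: if points of the unit sphere near to each other never have a common label
with the antipodes, then some point carries, up to a small error, an alternating increasing
sequence of `d + 2` labels. -/
theorem exists_alternating_labels {e : ℕ → F} {d : ℕ} (he : ∀ i ≤ d, ‖e i‖ = 1)
    (hee : ∀ i ≤ d, ∀ j ≤ d, i ≠ j → inner ℝ (e i) (e j) = 0) {η : ℝ} (hη : 0 < η) (m : F → ι)
    (hm : ∀ v w : F, ‖v‖ = 1 → ‖w‖ = 1 → dist v w ≤ η → m v ≠ m (-w)) :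
    ∃ (p : F) (s : Fin (d + 2) → ι), ‖p‖ = 1 ∧ StrictMono s ∧
      ∀ i : Fin (d + 2), ∃ v : F, ‖v‖ = 1 ∧ dist v p ≤ η ∧ m ((-1 : ℝ) ^ (i : ℕ) • v) = s i := by
  obtain ⟨N, hN⟩ := exists_nat_gt (d * Real.pi / η)
  have hN0 : 0 < N := by
    have : (0 : ℝ) < N := lt_of_le_of_lt (by positivity) hN
    exact_mod_cast this
  have hN' : (0 : ℝ) < N := by positivity
  have hdη : ∀ k ≤ d, (k : ℝ) * (Real.pi / N) ≤ η := by
    intro k hk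
    have : (k : ℝ) ≤ d := by exact_mod_cast hk
    rw [div_lt_iff₀ hη] at hN
    calc (k : ℝ) * (Real.pi / N) ≤ d * (Real.pi / N) := by gcongr
      _ = d * Real.pi / N := by ring
      _ ≤ η := by rw [div_le_iff₀ hN']; linarith
  have hne : ∀ v : F, ‖v‖ = 1 → m v ≠ m (-v) := fun v hv => hm v v hv hv (by simp [hη.le])
  set c := hemisphereChain e N with hc
  have hcm : ∀ k ≤ d, c k ∈ On (smallWords e d (Real.pi / N) k) :=
    fun k hk => hemisphereChain_mem he hee hN0 hk
  set lab := antipodalLabel m with hlab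
  set b : ℕ → WordChain (ι ×ₗ Bool) := fun k => sort (map lab (c k)) with hb
  have hsmall : ∀ k ≤ d, ∀ w ∈ smallWords e d (Real.pi / N) k, ∀ v ∈ w, ∀ v' ∈ w,
      dist v v' ≤ η := fun k hk w hw v hv v' hv' => (hw.2.2 v hv v' hv').trans (hdη k hk)
  -- On a small word distinct labels differ in their index, so flipping signs preserves their order
  -- and commutes with sorting.
  have hbd : ∀ k < d, bd (b (k + 1)) = b k + map flipLabel (b k) := by
    intro k hk
    simp only [hb]
    rw [bd_sort, bd_map, hc, bd_hemisphereChain e hN0 k, symmetrize, map_add, map_add]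
    congr 1
    refine eqOn (F := sort ∘ₗ map lab ∘ₗ map fun v => -v) (G := map flipLabel ∘ₗ sort ∘ₗ map lab)
      (fun w hw => ?_) (hcm k hk.le)
    simp only [LinearMap.comp_apply, map_word, sort_word]
    rw [← sortWord_map]
    · congr 1
      rw [List.map_map, List.map_map]
      exact List.map_congr_left fun v hv => antipodalLabel_neg (hne v (hw.2.1 v hv).1)
    · intro x hx y hy hxy
      obtain ⟨v, hv, rfl⟩ := List.mem_map.1 hx
      obtain ⟨v', hv', rfl⟩ := List.mem_map.1 hy
      rw [Prod.Lex.lt_iff] at hxy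
      rcases hxy with hxy | hxy
      · rw [Prod.Lex.lt_iff]
        exact Or.inl hxy
      · have := antipodalLabel_eq hm (hw.2.1 v hv).1 (hw.2.1 v' hv').1
          (hsmall k hk.le w hw v hv v' hv') hxy.1
        have h2 := hxy.2
        simp only [hlab, this] at h2
        exact absurd h2 (lt_irrefl _)
  have hbmem : b d ∈ On {t | t.Pairwise (· < ·) ∧ t.length = d + 1 ∧
      ∃ w ∈ smallWords e d (Real.pi / N) d, ∀ x ∈ t, x ∈ w.map lab} := by
    refine map_mem (F := sort ∘ₗ map lab) (fun w hw => ?_) (hcm d le_rfl)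
    rw [LinearMap.comp_apply, map_word, sort_word]
    refine Finsupp.supported_mono ?_ (sortWord_mem (w.map lab))
    rintro t ⟨h1, h2, h3⟩
    exact ⟨h1, by rw [h2, List.length_map, hw.1], w, hw, h3⟩
  have hlen : ∀ k ≤ d, b k ∈ On {w | w.length = k + 1} := by
    intro k hk
    refine map_mem (F := sort ∘ₗ map lab) (fun w hw => ?_) (hcm k hk)
    rw [LinearMap.comp_apply, map_word, sort_word]
    refine Finsupp.supported_mono ?_ (sortWord_mem (w.map lab))
    rintro t ⟨h1, h2, h3⟩
    simp [h2, hw.1]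
  have halt : alt labelSign (b d) = 1 := by
    rw [alt_eq_of_bd labelSign flipLabel labelSign_flipLabel b hlen hbd le_rfl]
    simp [hb, hc, hemisphereChain, sortWord, insertWord, altWord]
  obtain ⟨u, ⟨hu1, hu2, w, hw, huw⟩, hu3⟩ : ∃ u ∈ {t : List (ι ×ₗ Bool) | t.Pairwise (· < ·) ∧
      t.length = d + 1 ∧ ∃ w ∈ smallWords e d (Real.pi / N) d, ∀ x ∈ t, x ∈ w.map lab},
      altWord labelSign u ≠ 0 := by
    by_contra! hcon
    have := eqOn (F := alt labelSign) (G := 0) (fun w hw => by simpa using hcon w hw) hbmem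
    rw [halt] at this
    simp at this
  have hlt : ∀ i : Fin (d + 1), (i : ℕ) < u.length := fun i => by rw [hu2]; exact i.2
  have hpt : ∀ i : Fin (d + 1), ∃ v ∈ w, lab v = u[(i : ℕ)]'(hlt i) := fun i =>
    List.mem_map.1 (huw _ (List.getElem_mem _))
  choose v hvw hv using hpt
  have hv1 : ∀ i, ‖v i‖ = 1 := fun i => (hw.2.1 _ (hvw i)).1
  have hspec := fun i => antipodalLabel_spec (hne (v i) (hv1 i))
  have hmono : ∀ i j : Fin (d + 1), i < j → (ofLex (lab (v i))).1 < (ofLex (lab (v j))).1 := by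
    intro i j hij
    have h1 : lab (v i) < lab (v j) := by
      rw [hv, hv]
      exact List.pairwise_iff_getElem.1 hu1 _ _ _ _ hij
    refine lt_of_le_of_ne ?_ fun h => h1.ne (antipodalLabel_eq hm (hv1 i) (hv1 j)
      (hsmall d le_rfl w hw _ (hvw i) _ (hvw j)) h)
    rw [Prod.Lex.lt_iff] at h1
    rcases h1 with h1 | h1
    · exact h1.le
    · exact h1.1.le
  have hunit : ∀ (n : ℕ) (hn : n < d + 1),
      labelUnit (lab (v ⟨n, hn⟩)) = (-1) ^ n * labelUnit (lab (v 0)) := by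
    intro n
    induction n with
    | zero => intro hn; simp
    | succ n ih =>
      intro hn
      have h1 := List.isChain_iff_getElem.1 (isChain_of_altWord_ne_zero labelSign hu3) n
        (by rw [hu2]; lia)
      have h2 := labelUnit_eq_neg h1
      rw [← hv ⟨n, by lia⟩, ← hv ⟨n + 1, hn⟩] at h2
      rw [h2, ih (by lia), pow_succ]
      ring
  -- Multiplying all vertices by the first sign normalizes the alternation to `(-1) ^ i`.
  set σ := labelUnit (lab (v 0)) with hσ
  have hσ1 : ‖σ‖ = 1 := by
    rw [hσ, labelUnit]
    split_ifs <;> simp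
  -- The extra label is the value of `m` on the other side of the last vertex: it exceeds the last
  -- label, and its sign is again opposite.
  refine ⟨σ • v 0, Fin.snoc (fun i => (ofLex (lab (v i))).1)
    (m (-(labelUnit (lab (v (Fin.last d))) • v (Fin.last d)))), ?_, ?_, ?_⟩
  · rw [norm_smul, hσ1, hv1, mul_one]
  · rw [Fin.strictMono_iff_lt_succ]
    intro i
    rw [Fin.snoc_castSucc]
    induction i using Fin.lastCases with
    | last =>
      rw [Fin.succ_last, Fin.snoc_last]
      exact (hspec _).2
    | cast j =>
      rw [Fin.succ_castSucc, Fin.snoc_castSucc]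
      exact hmono _ _ j.castSucc_lt_succ
  · have hdist : ∀ i, dist (σ • v i) (σ • v 0) ≤ η := by
      intro i
      rw [dist_smul₀, hσ1, one_mul]
      exact hsmall d le_rfl w hw _ (hvw i) _ (hvw 0)
    intro i
    induction i using Fin.lastCases with
    | last =>
      refine ⟨σ • v (Fin.last d), by rw [norm_smul, hσ1, hv1, mul_one], hdist _, ?_⟩
      rw [Fin.snoc_last, smul_smul]
      have := hunit d (by lia)
      change labelUnit (lab (v (Fin.last d))) = _ at this
      rw [this, Fin.val_last, pow_succ, ← neg_smul]
      congr 2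
      ring
    | cast j =>
      refine ⟨σ • v j, by rw [norm_smul, hσ1, hv1, mul_one], hdist _, ?_⟩
      rw [Fin.snoc_castSucc, smul_smul]
      have := hunit j j.2
      rw [Fin.val_castSucc, ← this]
      exact (hspec j).1

end Fan

end

/-! ### Snakes in nets of the sphere -/

section Snake

theorem exists_basis_vectors (d : ℕ) : ∃ e : ℕ → EuclideanSpace ℝ (Fin (d + 1)),
    (∀ i ≤ d, ‖e i‖ = 1) ∧ ∀ i ≤ d, ∀ j ≤ d, i ≠ j → inner ℝ (e i) (e j) = 0 := by
  refine ⟨fun k => if h : k < d + 1 then EuclideanSpace.single ⟨k, h⟩ 1 else 0, ?_, ?_⟩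
  · intro i hi
    simp [Nat.lt_succ_iff.2 hi]
  · intro i hi j hj hij
    simp [Nat.lt_succ_iff.2 hi, Nat.lt_succ_iff.2 hj, EuclideanSpace.inner_single_left, hij]

instance instNonemptyUnitSphere (d : ℕ) : Nonempty (UnitSphere d) := by
  obtain ⟨e, he, -⟩ := exists_basis_vectors d
  exact ⟨⟨e 0, by simpa using he 0 (Nat.zero_le _)⟩⟩

theorem dist_neg_self_unitSphere {d : ℕ} (x : UnitSphere d) : dist x (-x) = 2 := by
  have hx : ‖(x : EuclideanSpace ℝ (Fin (d + 1)))‖ = 1 := norm_eq_of_mem_sphere x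
  rw [Subtype.dist_eq, coe_neg_sphere, dist_eq_norm, sub_neg_eq_add, ← two_smul ℝ, norm_smul, hx]
  norm_num

variable {d : ℕ} {ε : ℝ} {ι : Type*} [LinearOrder ι]

theorem exists_approximate_snake (hε : ε < Real.sqrt 2) (q : ι → UnitSphere d)
    (hq : ∀ p, ∃ i, dist p (q i) ≤ ε) {r : ℝ} (hr : 0 < r) :
    ∃ (x : UnitSphere d) (s : Fin (d + 2) → ι), StrictMono s ∧ ∀ i : Fin (d + 2),
      dist (q (s i) : EuclideanSpace ℝ (Fin (d + 1))) ((-1 : ℝ) ^ (i : ℕ) • x) ≤ ε + r := by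
  obtain ⟨e, he, hee⟩ := exists_basis_vectors d
  have hch : ∀ v : EuclideanSpace ℝ (Fin (d + 1)), ∃ i, ‖v‖ = 1 →
      dist v (q i : EuclideanSpace ℝ (Fin (d + 1))) ≤ ε := by
    intro v
    by_cases hv : ‖v‖ = 1
    · obtain ⟨i, hi⟩ := hq ⟨v, by simpa using hv⟩
      exact ⟨i, fun _ => hi⟩
    · obtain ⟨i, -⟩ := hq (Classical.arbitrary _)
      exact ⟨i, fun h => absurd h hv⟩
  choose m hm using hch
  set η := min ((Real.sqrt 2 - ε) / 2) r with hη
  have hη0 : 0 < η := lt_min (by linarith) hr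
  have hη1 : ε + η < Real.sqrt 2 := by
    have : η ≤ (Real.sqrt 2 - ε) / 2 := min_le_left _ _
    linarith
  obtain ⟨p, s, hp, hs, h⟩ := exists_alternating_labels he hee hη0 m (by
    intro v w hv hw hvw heq
    have h1 := hm v hv
    have h2 := hm (-w) (by rwa [norm_neg])
    rw [← heq] at h2
    have hx : ‖(q (m v) : EuclideanSpace ℝ (Fin (d + 1)))‖ = 1 := norm_eq_of_mem_sphere _
    generalize (q (m v) : EuclideanSpace ℝ (Fin (d + 1))) = x at h1 h2 hx
    rw [dist_eq_norm] at h1 hvw h2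
    have h3 : ‖v + x‖ ≤ ε + η := by
      -- A point `x` labelling both `v` and `-w` has `‖v - x‖` and `‖v + x‖` below `√2`, whereas
      -- their squares add up to 4.
      have : v + x = (v - w) - (-w - x) := by abel
      rw [this]
      exact (norm_sub_le _ _).trans (by linarith)
    have h4 := parallelogram_law_with_norm ℝ v x
    rw [hv, hx] at h4
    have h5 : Real.sqrt 2 * Real.sqrt 2 = 2 := Real.mul_self_sqrt (by norm_num)
    have h6 : ‖v + x‖ * ‖v + x‖ < Real.sqrt 2 * Real.sqrt 2 :=
      mul_self_lt_mul_self (norm_nonneg _) (by linarith)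
    have h7 : ‖v - x‖ * ‖v - x‖ < Real.sqrt 2 * Real.sqrt 2 :=
      mul_self_lt_mul_self (norm_nonneg _) (by linarith)
    linarith)
  refine ⟨⟨p, by simpa using hp⟩, s, hs, fun i => ?_⟩
  obtain ⟨v, hv, hvp, hvm⟩ := h i
  have hone : ‖(-1 : ℝ) ^ (i : ℕ)‖ = 1 := by simp
  have h1 := hm ((-1 : ℝ) ^ (i : ℕ) • v) (by rw [norm_smul, hone, hv, mul_one])
  rw [hvm, dist_comm] at h1
  have h2 : dist ((-1 : ℝ) ^ (i : ℕ) • v) ((-1 : ℝ) ^ (i : ℕ) • p) ≤ η := by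
    rwa [dist_smul₀, hone, one_mul]
  have h3 : η ≤ r := min_le_right _ _
  exact (dist_triangle _ _ _).trans (by linarith)

/-- There are finitely many index sequences, so one of them works for arbitrarily small errors; the
nested compact sets of admissible `x` then have a common point. The shift `i + 1` turns indices from
0 into positions from 1. -/
theorem exists_snake [Finite ι] (hε : ε < Real.sqrt 2) (q : ι → UnitSphere d)
    (hq : ∀ p, ∃ i, dist p (q i) ≤ ε) :
    ∃ (x : UnitSphere d) (s : Fin (d + 2) → ι), StrictMono s ∧
      (∀ i : Fin (d + 2), Odd ((i : ℕ) + 1) → dist (q (s i)) x ≤ ε) ∧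
      (∀ i : Fin (d + 2), Even ((i : ℕ) + 1) → dist (q (s i)) (-x) ≤ ε) := by
  have : Fintype ι := Fintype.ofFinite ι
  set K : (Fin (d + 2) → ι) → ℕ → Set (UnitSphere d) := fun s n => {x | ∀ i : Fin (d + 2),
    dist (q (s i) : EuclideanSpace ℝ (Fin (d + 1))) ((-1 : ℝ) ^ (i : ℕ) • x) ≤
      ε + 1 / ((n : ℝ) + 1)} with hK
  have hanti : ∀ s n k, n ≤ k → K s k ⊆ K s n := by
    intro s n k hnk x hx i
    refine (hx i).trans ?_
    gcongr
  have hclosed : ∀ s n, IsClosed (K s n) := by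
    intro s n
    simp only [hK, Set.ofPred_forall]
    exact isClosed_iInter fun i => isClosed_le (by fun_prop) continuous_const
  obtain ⟨s, hs, hsK⟩ : ∃ s : Fin (d + 2) → ι, StrictMono s ∧ ∀ n, (K s n).Nonempty := by
    by_contra! hcon
    have h1 : ∀ s : Fin (d + 2) → ι, ∃ n, StrictMono s → K s n = ∅ := by
      intro s
      by_cases hs : StrictMono s
      · obtain ⟨n, hn⟩ := hcon s hs
        exact ⟨n, fun _ => hn⟩
      · exact ⟨0, fun h => absurd h hs⟩
    choose n hn using h1
    -- If each sequence failed at some error `1 / (n s + 1)`, all would fail at a common smaller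
    -- one.
    obtain ⟨k, hk⟩ := Finset.exists_le (Finset.univ.image n)
    obtain ⟨x, s, hs, hx⟩ := exists_approximate_snake hε q hq
      (r := 1 / ((k : ℝ) + 1)) (by positivity)
    have hxk : x ∈ K s (n s) := hanti s _ k (hk _ (by simp)) hx
    rw [hn s hs] at hxk
    exact hxk
  obtain ⟨x, hx⟩ := IsCompact.nonempty_iInter_of_sequence_nonempty_isCompact_isClosed (K s)
    (fun n => hanti s n (n + 1) n.le_succ) hsK (hclosed s 0).isCompact (hclosed s)
  rw [Set.mem_iInter] at hx
  have hlim : ∀ i : Fin (d + 2),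
      dist (q (s i) : EuclideanSpace ℝ (Fin (d + 1))) ((-1 : ℝ) ^ (i : ℕ) • x) ≤ ε := by
    intro i
    have h1 : Filter.Tendsto (fun n : ℕ => ε + 1 / ((n : ℝ) + 1)) Filter.atTop (nhds (ε + 0)) :=
      tendsto_const_nhds.add tendsto_one_div_add_atTop_nhds_zero_nat
    rw [add_zero] at h1
    exact ge_of_tendsto' h1 fun n => hx n i
  refine ⟨x, s, hs, fun i hi => ?_, fun i hi => ?_⟩
  · have h1 : Even (i : ℕ) := by rcases Nat.even_or_odd (i : ℕ) with h | h
                                 · exact h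
                                 · exact absurd h.add_one (Nat.not_even_iff_odd.2 hi)
    simpa [Subtype.dist_eq, h1.neg_one_pow] using hlim i
  · have h1 : Odd (i : ℕ) := by rcases Nat.even_or_odd (i : ℕ) with h | h
                                · exact absurd h.add_one (Nat.not_odd_iff_even.2 hi)
                                · exact h
    simpa [Subtype.dist_eq, h1.neg_one_pow] using hlim i

/-- Two points of the net with a common approximant at distance below `δ / 2` coincide. -/
theorem IsNet.finite {M : Type*} [MetricSpace M] [CompactSpace M] {δ : ℝ} (hδ : 0 < δ)
    {X : Set M} (hX : IsNet ε δ X) : X.Finite := by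
  obtain ⟨t, -, ht, hcov⟩ := Metric.finite_approx_of_totallyBounded
    (isCompact_univ (X := M)).totallyBounded (δ / 2) (by positivity)
  have h1 : ∀ x : M, ∃ y ∈ t, dist x y < δ / 2 := by
    intro x
    simpa using hcov (Set.mem_univ x)
  choose f hft hf using h1
  refine ht.of_injOn (f := f) (fun x _ => hft x) fun x hx y hy hxy => ?_
  by_contra hne
  have h2 := hX.separated x hx y hy hne
  have h3 := dist_triangle_right x y (f x)
  have h4 := hf y
  rw [← hxy] at h4
  linarith [hf x]

theorem snakeWidth_le {x : UnitSphere d} {s : Fin (d + 2) → UnitSphere d}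
    (hodd : ∀ i : Fin (d + 2), Odd ((i : ℕ) + 1) → dist (s i) x ≤ ε)
    (heven : ∀ i : Fin (d + 2), Even ((i : ℕ) + 1) → dist (s i) (-x) ≤ ε) :
    snakeWidth s ≤ 2 * ε := by
  refine csSup_le ⟨_, 0, 0, rfl, rfl⟩ ?_
  rintro _ ⟨i, j, hij, rfl⟩
  rcases Nat.even_or_odd ((i : ℕ) + 1) with h | h
  · have h1 := heven i h
    have h2 := heven j (by rw [Nat.even_iff] at h ⊢; lia)
    linarith [dist_triangle_right (s i) (s j) (-x)]
  · have h1 := hodd i h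
    have h2 := hodd j (by rw [Nat.odd_iff] at h ⊢; lia)
    linarith [dist_triangle_right (s i) (s j) x]

theorem dist_succ_ge {x : UnitSphere d} {s : Fin (d + 2) → UnitSphere d}
    (hodd : ∀ i : Fin (d + 2), Odd ((i : ℕ) + 1) → dist (s i) x ≤ ε)
    (heven : ∀ i : Fin (d + 2), Even ((i : ℕ) + 1) → dist (s i) (-x) ≤ ε)
    {i j : Fin (d + 2)} (hij : (j : ℕ) = i + 1) : 2 - 2 * ε ≤ dist (s i) (s j) := by
  have h0 := dist_neg_self_unitSphere x
  rcases Nat.even_or_odd ((i : ℕ) + 1) with h | h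
  · have h1 := heven i h
    have h2 := hodd j (by rw [hij]; exact h.add_one)
    linarith [dist_triangle4 x (s j) (s i) (-x), dist_comm x (s j), dist_comm (s i) (s j)]
  · have h1 := hodd i h
    have h2 := heven j (by rw [hij]; exact h.add_one)
    linarith [dist_triangle4 x (s i) (s j) (-x), dist_comm x (s i)]

end Snake

/-! ### Lengths of paths and the upper bound -/

section PathLength

variable {M : Type*} [MetricSpace M]

theorem pathLength_nonneg (l : List M) : 0 ≤ pathLength l := by
  match l with
  | [] => exact le_rfl
  | [_] => exact le_rfl
  | x :: y :: l => exact add_nonneg dist_nonneg (pathLength_nonneg (y :: l))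

theorem dist_le_pathLength {l : List M} {x y : M} (hx : x ∈ l) (hy : y ∈ l) :
    dist x y ≤ pathLength l := by
  match l with
  | [a] => simp_all [pathLength]
  | a :: b :: l =>
    have hb : ∀ z ∈ b :: l, dist b z ≤ pathLength (b :: l) :=
      fun z hz => dist_le_pathLength (by simp) hz
    have h0 := pathLength_nonneg (b :: l)
    have h1 : 0 ≤ dist a b := dist_nonneg
    rw [pathLength]
    rcases List.mem_cons.1 hx with rfl | hx' <;> rcases List.mem_cons.1 hy with rfl | hy'
    · rw [dist_self]; positivity
    · linarith [dist_triangle x b y, hb y hy']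
    · linarith [dist_triangle x b y, hb x hx', dist_comm b x, dist_comm b y]
    · linarith [dist_le_pathLength hx' hy']

theorem pathLength_le {l : List M} {D : ℝ} (hD : 0 ≤ D) (h : ∀ x ∈ l, ∀ y ∈ l, dist x y ≤ D)
    {n : ℕ} (hn : l.length ≤ n + 1) : pathLength l ≤ n * D := by
  match l, n with
  | [], _ => rw [pathLength]; positivity
  | [_], _ => rw [pathLength]; positivity
  | x :: y :: l, 0 => simp at hn
  | x :: y :: l, n + 1 =>
    have h1 := pathLength_le hD (l := y :: l) (n := n)
      (fun a ha b hb => h a (by simp_all) b (by simp_all)) (by simpa using hn)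
    have h2 := h x (by simp) y (by simp)
    rw [pathLength]
    push_cast
    linarith

theorem le_pathLength {l : List M} {c : ℝ} (h : l.IsChain fun x y => c ≤ dist x y) {n : ℕ}
    (hn : l.length = n + 1) : n * c ≤ pathLength l := by
  match l, n with
  | [_], 0 => simp [pathLength]
  | x :: y :: l, 0 => simp at hn
  | x :: y :: l, n + 1 =>
    rw [List.isChain_cons_cons] at h
    have h1 := le_pathLength h.2 (n := n) (by simpa using hn)
    rw [pathLength]
    push_cast
    linarith [h.1]

theorem pathLength_cons_le {l : List M} {a p : M} {r : ℝ} (ha : dist a p ≤ r)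
    (hl : ∀ x ∈ l, dist x p ≤ r) : pathLength (a :: l) ≤ 2 * r * l.length := by
  induction l generalizing a with
  | nil => simp [pathLength]
  | cons b l ih =>
    have hb := hl b (by simp)
    have h1 := ih hb fun x hx => hl x (by simp [hx])
    rw [pathLength, List.length_cons]
    push_cast
    linarith [dist_triangle_right a b p]

/-- Only the passage from the cluster at `p` to the one at `p'` costs `D`; any other step stays in a
ball of radius `r`. -/
theorem pathLength_append_le {l₁ l₂ : List M} {a p p' : M} {r D : ℝ} (hD : ∀ x y : M, dist x y ≤ D)
    (ha : dist a p ≤ r) (h₁ : ∀ x ∈ l₁, dist x p ≤ r) (h₂ : ∀ x ∈ l₂, dist x p' ≤ r) :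
    pathLength (a :: (l₁ ++ l₂)) ≤ D + 2 * r * (l₁.length + l₂.length) := by
  have hr : 0 ≤ r := dist_nonneg.trans ha
  induction l₁ generalizing a with
  | nil =>
    match l₂ with
    | [] => simpa [pathLength] using dist_nonneg.trans (hD a a)
    | b :: l =>
      have h1 := pathLength_cons_le (l := l) (h₂ b (by simp)) fun x hx => h₂ x (by simp [hx])
      simp only [List.nil_append, pathLength, List.length_nil, List.length_cons]
      push_cast
      linarith [hD a b]
  | cons b l ih =>
    have hb := h₁ b (by simp)
    have h1 := ih hb fun x hx => h₁ x (by simp [hx])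
    simp only [List.cons_append, pathLength, List.length_cons] at h1 ⊢
    push_cast
    linarith [dist_triangle_right a b p]

theorem optLength_le {X : Finset M} {l : List M} (h : ∀ x ∈ X, x ∈ l) :
    optLength X ≤ pathLength l :=
  csInf_le ⟨0, by rintro _ ⟨l, -, rfl⟩; exact pathLength_nonneg l⟩ ⟨l, h, rfl⟩

theorem dist_le_optLength {X : Finset M} {x y : M} (hx : x ∈ X) (hy : y ∈ X) :
    dist x y ≤ optLength X := by
  refine le_csInf ⟨_, X.toList, by simp, rfl⟩ ?_
  rintro _ ⟨l, hl, rfl⟩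
  exact dist_le_pathLength (hl x hx) (hl y hy)

theorem optLength_pos {X : Finset M} (hX : 2 ≤ X.card) : 0 < optLength X := by
  obtain ⟨x, hx, y, hy, hne⟩ := Finset.one_lt_card.1 hX
  exact (dist_pos.2 hne).trans_le (dist_le_optLength hx hy)

theorem orderLength_le (T : LinearOrder M) {X : Finset M} (hX : 2 ≤ X.card) {n : ℕ}
    (hn : X.card ≤ n + 1) : orderLength T X ≤ n * optLength X := by
  let := T
  refine pathLength_le (optLength_pos hX).le (fun x hx y hy => ?_) (by simpa using hn)
  exact dist_le_optLength ((Finset.mem_sort _).1 hx) ((Finset.mem_sort _).1 hy)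

theorem orderLength_toFinset (T : LinearOrder M) [DecidableEq M] {l : List M}
    (hl : l.Pairwise T.lt) : orderLength T l.toFinset = pathLength l := by
  let := T
  have h1 : l.Nodup := hl.imp fun h => ne_of_lt h
  have h2 : l.Pairwise (· ≤ ·) := hl.imp fun h => le_of_lt h
  rw [orderLength, (List.toFinset_sort (fun a b : M => a ≤ b) h1).2 h2]

theorem orderRatio_le (T : LinearOrder M) {k : ℕ} (hk : 1 ≤ k) : orderRatio M T k ≤ k := by
  classical
  rw [orderRatio]
  split_ifs
  · exact_mod_cast hk
  · refine iSup₂_le fun X hX => ?_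
    rw [← ENNReal.ofReal_natCast]
    refine ENNReal.ofReal_le_ofReal ?_
    rw [div_le_iff₀ (optLength_pos hX.1)]
    exact orderLength_le T hX.1 hX.2

end PathLength

/-! ### The order ratio of the sphere -/

theorem optLength_toFinset_le {d : ℕ} [DecidableEq (UnitSphere d)] {ε : ℝ} {x : UnitSphere d}
    {s : Fin (d + 2) → UnitSphere d}
    (hodd : ∀ i : Fin (d + 2), Odd ((i : ℕ) + 1) → dist (s i) x ≤ ε)
    (heven : ∀ i : Fin (d + 2), Even ((i : ℕ) + 1) → dist (s i) (-x) ≤ ε) :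
    optLength (List.ofFn s).toFinset ≤ 2 + 2 * ε * (d + 1) := by
  -- The tour starts at `s 0`, goes through the remaining points near `x`, then through those near
  -- `-x`; `l` lists the indices other than `0`.
  set l := (List.finRange (d + 1)).map Fin.succ with hl
  refine (optLength_le (l := s 0 :: ((l.filter fun i : Fin (d + 2) => Odd ((i : ℕ) + 1)).map s ++
    (l.filter fun i : Fin (d + 2) => ¬ Odd ((i : ℕ) + 1)).map s)) ?_).trans
    ((pathLength_append_le (p := x) (p' := -x) (D := 2) (r := ε) ?_ ?_ ?_ ?_).trans ?_)
  · intro y hy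
    rw [List.mem_toFinset, List.mem_ofFn] at hy
    obtain ⟨i, rfl⟩ := hy
    induction i using Fin.cases with
    | zero => simp
    | succ j =>
      refine List.mem_cons_of_mem _ (List.mem_append.2 ?_)
      have hj : j.succ ∈ l := by simp [hl]
      by_cases h : Odd ((j.succ : ℕ) + 1)
      · exact Or.inl (List.mem_map_of_mem (List.mem_filter.2 ⟨hj, by simpa using h⟩))
      · exact Or.inr (List.mem_map_of_mem (List.mem_filter.2 ⟨hj, by simpa using h⟩))
  · intro y z
    have hy : dist (y : EuclideanSpace ℝ (Fin (d + 1))) 0 = 1 := y.2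
    have hz : dist (z : EuclideanSpace ℝ (Fin (d + 1))) 0 = 1 := z.2
    rw [Subtype.dist_eq]
    linarith [dist_triangle_right (y : EuclideanSpace ℝ (Fin (d + 1))) z 0]
  · exact hodd 0 (by simp)
  · intro y hy
    obtain ⟨i, hi, rfl⟩ := List.mem_map.1 hy
    exact hodd i (by simpa using (List.mem_filter.1 hi).2)
  · intro y hy
    obtain ⟨i, hi, rfl⟩ := List.mem_map.1 hy
    exact heven i (Nat.not_odd_iff_even.1 (by simpa using (List.mem_filter.1 hi).2))
  · have h1 := List.length_eq_length_filter_add (l := l) fun i : Fin (d + 2) => Odd ((i : ℕ) + 1)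
    have h2 : l.length = d + 1 := by simp [hl]
    rw [h2] at h1
    have h3 : ((l.filter fun i : Fin (d + 2) => Odd ((i : ℕ) + 1)).length : ℝ) +
        (l.filter fun i : Fin (d + 2) => ¬ Odd ((i : ℕ) + 1)).length = d + 1 := by
      have h4 : (l.filter fun i : Fin (d + 2) => ¬ Odd ((i : ℕ) + 1)).length =
          (l.filter fun i : Fin (d + 2) => !decide (Odd ((i : ℕ) + 1))).length := by
          simp only [decide_not]
      rw [h4]
      exact_mod_cast h1.symm
    rw [List.length_map, List.length_map, h3]

theorem exists_finite_cover (d : ℕ) {ε : ℝ} (hε0 : 0 < ε) :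
    ∃ t : Set (UnitSphere d), t.Finite ∧ ∀ p : UnitSphere d, ∃ i : t, dist p i ≤ ε := by
  obtain ⟨t, -, ht, hcov⟩ := Metric.finite_approx_of_totallyBounded
    (isCompact_univ (X := UnitSphere d)).totallyBounded ε hε0
  refine ⟨t, ht, fun p => ?_⟩
  have := hcov (Set.mem_univ p)
  simp only [Set.mem_iUnion, Metric.mem_ball] at this
  obtain ⟨y, hy, h⟩ := this
  exact ⟨⟨y, hy⟩, h.le⟩

/-- Restrict the order to a finite `ε`-cover; separation plays no role. -/
theorem exists_snake_of_linearOrder {d : ℕ} (T : LinearOrder (UnitSphere d)) {ε : ℝ}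
    (hε0 : 0 < ε) (hε : ε < Real.sqrt 2) :
    ∃ (x : UnitSphere d) (s : Fin (d + 2) → UnitSphere d), IsSnake T s ∧
      (∀ i : Fin (d + 2), Odd ((i : ℕ) + 1) → dist (s i) x ≤ ε) ∧
      (∀ i : Fin (d + 2), Even ((i : ℕ) + 1) → dist (s i) (-x) ≤ ε) := by
  obtain ⟨t, ht, hcov⟩ := exists_finite_cover d hε0
  have : Finite t := ht
  obtain ⟨x, s, hs, hodd, heven⟩ := exists_snake hε (fun i : t => (i : UnitSphere d)) hcov
  exact ⟨x, fun i => s i, fun i j hij => hs hij, hodd, heven⟩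

theorem le_orderLength {M : Type*} [MetricSpace M] [DecidableEq M] {T : LinearOrder M} {n : ℕ}
    {s : Fin (n + 1) → M} (hs : IsSnake T s) {c : ℝ}
    (hc : ∀ i j : Fin (n + 1), (j : ℕ) = i + 1 → c ≤ dist (s i) (s j)) :
    n * c ≤ orderLength T (List.ofFn s).toFinset := by
  rw [orderLength_toFinset T (List.pairwise_ofFn.2 fun i j hij => hs i j hij)]
  refine le_pathLength (List.isChain_iff_getElem.2 fun i hi => ?_) (by simp)
  rw [List.getElem_ofFn, List.getElem_ofFn]
  exact hc _ _ rfl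

theorem card_toFinset_ofFn {M : Type*} [MetricSpace M] [DecidableEq M] {T : LinearOrder M} {n : ℕ}
    {s : Fin n → M} (hs : IsSnake T s) : (List.ofFn s).toFinset.card = n := by
  have h : (List.ofFn s).Nodup :=
    List.pairwise_ofFn.2 fun i j hij => @ne_of_lt M T.toPreorder _ _ (hs i j hij)
  rw [List.toFinset_card_of_nodup h, List.length_ofFn]

theorem not_subsingleton_unitSphere (d : ℕ) : ¬ Subsingleton (UnitSphere d) := fun h => by
  have h2 := dist_neg_self_unitSphere (Classical.arbitrary (UnitSphere d))
  rw [Subsingleton.elim (-Classical.arbitrary (UnitSphere d)) _, dist_self] at h2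
  norm_num at h2

theorem le_orderRatio_of_lt_one {d : ℕ} (T : LinearOrder (UnitSphere d)) {ε : ℝ} (hε0 : 0 < ε)
    (hε : ε < 1) :
    ENNReal.ofReal (((d + 1 : ℕ) * (2 - 2 * ε)) / (2 + 2 * ε * (d + 1))) ≤
      orderRatio (UnitSphere d) T (d + 1) := by
  obtain ⟨X, hcard, hlong, hshort⟩ : ∃ X : Finset (UnitSphere d), X.card = d + 2 ∧
      (d + 1 : ℕ) * (2 - 2 * ε) ≤ orderLength T X ∧ optLength X ≤ 2 + 2 * ε * (d + 1) := by
    classical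
    obtain ⟨x, s, hs, hodd, heven⟩ := exists_snake_of_linearOrder T hε0
      (hε.trans (Real.lt_sqrt_of_sq_lt (by norm_num)))
    exact ⟨(List.ofFn s).toFinset, card_toFinset_ofFn hs,
      le_orderLength hs fun i j hij => dist_succ_ge hodd heven hij,
      optLength_toFinset_le hodd heven⟩
  rw [orderRatio, if_neg (not_subsingleton_unitSphere d)]
  refine le_iSup₂_of_le X ⟨by omega, by omega⟩ (ENNReal.ofReal_le_ofReal ?_)
  exact div_le_div₀ (pathLength_nonneg _) hlong (optLength_pos (by omega)) hshort

theorem le_orderRatio {d : ℕ} (T : LinearOrder (UnitSphere d)) :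
    (d : ℝ≥0∞) + 1 ≤ orderRatio (UnitSphere d) T (d + 1) := by
  have hcont : ContinuousAt
      (fun ε : ℝ => ((d + 1 : ℕ) * (2 - 2 * ε)) / (2 + 2 * ε * (d + 1))) 0 := by
    refine ContinuousAt.div (by fun_prop) (by fun_prop) (by norm_num)
  have h1 := (ENNReal.continuous_ofReal.continuousAt.comp hcont).tendsto.mono_left
    (nhdsWithin_le_nhds (s := Set.Ioi 0))
  have h2 : ENNReal.ofReal (((d + 1 : ℕ) * (2 - 2 * (0 : ℝ))) / (2 + 2 * 0 * (d + 1))) =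
      (d : ℝ≥0∞) + 1 := by
    have : (((d + 1 : ℕ) : ℝ) * (2 - 2 * (0 : ℝ))) / (2 + 2 * 0 * (d + 1)) = (d + 1 : ℕ) := by
      ring
    rw [this, ENNReal.ofReal_natCast]
    push_cast
    rfl
  rw [← h2]
  refine le_of_tendsto h1 ?_
  filter_upwards [Ioo_mem_nhdsGT (zero_lt_one' ℝ)] with ε hε
  exact le_orderRatio_of_lt_one T hε.1 hε.2

theorem mainTheorem5 (d : ℕ) :
    (∀ (ε δ : ℝ), 0 < ε → ε < Real.sqrt 2 → 0 < δ →
      ∀ X : Set (UnitSphere d), IsNet ε δ X → ∀ T : LinearOrder X,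
        ∃ (x : UnitSphere d) (s : Fin (d + 2) → X),
          IsSnake T s ∧
          (∀ i : Fin (d + 2), Odd ((i : ℕ) + 1) → dist (s i : UnitSphere d) x ≤ ε) ∧
          (∀ i : Fin (d + 2), Even ((i : ℕ) + 1) → dist (s i : UnitSphere d) (-x) ≤ ε) ∧
          2 - 2 * ε ≤ snakeLength s ∧
          snakeWidth s ≤ 2 * ε) ∧
    spaceOrderRatio (UnitSphere d) (d + 1) = (d : ENNReal) + 1 := by
  constructor
  · intro ε δ hε0 hε hδ X hX T
    have : Finite X := hX.finite hδ
    obtain ⟨x, s, hs, hodd, heven⟩ := exists_snake hε (fun i : X => (i : UnitSphere d))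
      fun p => by
        obtain ⟨u, hu, h⟩ := hX.covers p
        exact ⟨⟨u, hu⟩, h⟩
    refine ⟨x, s, fun i j hij => hs hij, hodd, heven, ?_, snakeWidth_le hodd heven⟩
    refine (dist_succ_ge hodd heven (i := 0) (j := 1) (by simp)).trans ?_
    exact Metric.dist_le_diam_of_mem (Set.finite_range s).isBounded ⟨0, rfl⟩ ⟨1, rfl⟩
  · refine le_antisymm ?_ (le_iInf fun T => le_orderRatio T)
    -- The upper bound holds for every order; it remains only to have one.
    obtain ⟨T, -⟩ := exists_wellFoundedLT (UnitSphere d)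
    refine (iInf_le _ T).trans ((orderRatio_le T (by lia)).trans ?_)
    push_cast
    exact le_rfl
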